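/- Let $\mathbb{P}$ be the set of all primes and let $\sigma=\{\sigma_i\mid i\in I\}$ be a partition of $\mathbb{P}$, that is, $\mathbb{P}=\bigcup_{i\in I}\sigma_i$ and $\sigma_i\cap\sigma_j=\emptyset$ for all $i\neq j$. All groups are finite. A $\sigma_i$-group is a group whose order has all its prime divisors in $\sigma_i$; a group is $\sigma$-primary if it is a $\sigma_i$-group for some $i\in I$, and $\sigma$-soluble if each of its chief factors is $\sigma$-primary. A Hall $\sigma_i$-subgroup of $G$ is a $\sigma_i$-subgroup $H$ of $G$ such that no prime in $\sigma_i$ divides $|G:H|$. A subgroup $A$ of $G$ is $\sigma$-subnormal in $G$ if there is a chain of subgroups $A=A_0\le A_1\le\cdots\le A_n=G$ such that, for each $k=1,\dots,n$, either $A_{k-1}$ is normal in $A_k$ or $A_k/(A_{k-1})_{A_k}$ is $\sigma$-primary, where $(A_{k-1})_{A_k}$ is the largest normal subgroup of $A_k$ contained in $A_{k-1}$. The group $G$ is a $T_\sigma$-group if every $\sigma$-subnormal subgroup of $G$ is normal in $G$; it is a $T$-group if $H\trianglelefteq K\trianglelefteq G$ always implies $H\trianglelefteq G$; and it is a Dedekind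 group if every subgroup of $G$ is normal in $G$. **Corollary 2.17.** A $\sigma$-soluble group $G$ is a $T_\sigma$-group if and only if $G$ is a $T$-group and, for every $i\in I$, every Hall $\sigma_i$-subgroup of $G$ is a Dedekind group. -/

import Mathlib

namespace SigmaGroup

/-- The family `σ` is a partition of the set of all primes (empty members are permitted). -/
structure IsPrimePartition {I : Type*} (σ : I → Set ℕ) : Prop where
  iUnion_eq : ⋃ i, σ i = {p : ℕ | p.Prime}
  disjoint : ∀ i j, i ≠ j → Disjoint (σ i) (σ j)

/-- All prime divisors of the order of the (finite) group `G` lie in `π`. -/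
def IsPiGroup (π : Set ℕ) (G : Type*) [Group G] : Prop :=
  ∀ p : ℕ, p.Prime → p ∣ Nat.card G → p ∈ π

/-- `G` is a `σ i`-group for some `i`. -/
def IsSigmaPrimary {I : Type*} (σ : I → Set ℕ) (G : Type*) [Group G] : Prop :=
  ∃ i, IsPiGroup (σ i) G

/-- Every chief factor `H / K` of `G` is `σ`-primary. -/
def IsSigmaSoluble {I : Type*} (σ : I → Set ℕ) (G : Type*) [Group G] : Prop :=
  ∀ (K H : Subgroup G) [K.Normal] [H.Normal], K < H →
    (∀ N : Subgroup G, N.Normal → K ≤ N → N ≤ H → N = K ∨ N = H) →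
    IsSigmaPrimary σ (H ⧸ K.subgroupOf H)

/-- `A` is `σ`-subnormal in `G`: there is a chain `A = c 0 ≤ c 1 ≤ ⋯ ≤ c n = G` in which each
`c i` is normal in `c (i + 1)`, or the quotient of `c (i + 1)` by the core of `c i` in `c (i + 1)`
is `σ`-primary. -/
def IsSigmaSubnormal {I : Type*} (σ : I → Set ℕ) {G : Type*} [Group G] (A : Subgroup G) : Prop :=
  ∃ (n : ℕ) (c : ℕ → Subgroup G), c 0 = A ∧ c n = ⊤ ∧
    ∀ i < n, c i ≤ c (i + 1) ∧
      (((c i).subgroupOf (c (i + 1))).Normal ∨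
        IsSigmaPrimary σ (c (i + 1) ⧸ ((c i).subgroupOf (c (i + 1))).normalCore))

/-- Every `σ`-subnormal subgroup of `G` is normal. -/
def IsTSigmaGroup {I : Type*} (σ : I → Set ℕ) (G : Type*) [Group G] : Prop :=
  ∀ A : Subgroup G, IsSigmaSubnormal σ A → A.Normal

/-- Normality is transitive in `G`. -/
def IsTGroup (G : Type*) [Group G] : Prop :=
  ∀ H K : Subgroup G, H ≤ K → (H.subgroupOf K).Normal → K.Normal → H.Normal

/-- `H` is a Hall `π`-subgroup of `G`: it is a `π`-group whose index has no prime divisor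
in `π`. -/
def IsHallSubgroup (π : Set ℕ) {G : Type*} [Group G] (H : Subgroup G) : Prop :=
  IsPiGroup π H ∧ ∀ p : ℕ, p.Prime → p ∣ H.index → p ∉ π

/-- Every subgroup of `G` is normal (abelian groups included). -/
def IsDedekindGroup (G : Type*) [Group G] : Prop :=
  ∀ H : Subgroup G, H.Normal

end SigmaGroup

/-! ### Indices, complements and chief factors in finite groups -/

namespace Subgroup

variable {G : Type*} [Group G]

/-! If `G` is a Tσ-group, every subgroup between the terms of a chief factor is σ-subnormal, hence
normal. So chief factors are cyclic and `G'` is nilpotent. Let `N` be the largest normal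
σᵢ'-subgroup and `H` a Hall σᵢ-subgroup. Each Sylow subgroup of `G'` is normal in `G`, so lies in
`H` or `N`; thus `G' ≤ HN` and `HN` is normal. As `HN/N` is a σᵢ-group, `AN` is normal for each `A ≤
H`, and so is `A = AN ∩ H` in `H`.

Conversely, σ-solubility yields Hall σᵢ-subgroups by Schur–Zassenhaus. If `A ≤ M`, `M` is normal in
`G` and `M/A_M` is a σᵢ-group, then `M = (H ∩ M)A_M`, so a Dedekind `H` makes `A` normal in `M`, and
the T-property makes it normal in `G`. Descend along the chain. -/

theorem relIndex_dvd_index_of_normal_right [Finite G] (H M : Subgroup G) [M.Normal] :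
    H.relIndex M ∣ H.index := by
  have h1 : Nat.card M * M.relIndex (H ⊔ M) = Nat.card (H ⊔ M : Subgroup G) := by
    rw [← relIndex_bot_left, ← relIndex_bot_left, relIndex_mul_relIndex _ _ _ bot_le le_sup_right]
  have h2 : Nat.card H * H.relIndex (H ⊔ M) = Nat.card (H ⊔ M : Subgroup G) := by
    rw [← relIndex_bot_left, ← relIndex_bot_left, relIndex_mul_relIndex _ _ _ bot_le le_sup_left]
  have h3 : Nat.card (H ⊓ M : Subgroup G) * M.relIndex H = Nat.card H := by
    rw [← inf_relIndex_left, ← relIndex_bot_left, ← relIndex_bot_left,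
      relIndex_mul_relIndex _ _ _ bot_le inf_le_left]
  have h4 : Nat.card (H ⊓ M : Subgroup G) * H.relIndex M = Nat.card M := by
    rw [← inf_relIndex_right, ← relIndex_bot_left, ← relIndex_bot_left,
      relIndex_mul_relIndex _ _ _ bot_le inf_le_right]
  -- `|HM : H| = |M : H ∩ M|`, on counting `HM` in two ways.
  have h5 : H.relIndex (H ⊔ M) = H.relIndex M := by
    rw [relIndex_sup_right] at h1
    refine Nat.eq_of_mul_eq_mul_left (Nat.card_pos (α := H)) ?_
    rw [h2, ← h1, ← h3, ← h4]
    ring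
  exact h5 ▸ relIndex_dvd_index_of_le le_sup_left

/-- By the modular law `A = (A ∩ H)C`; `H` normalizes both factors, and `C ≤ A` normalizes `A`. -/
theorem normal_of_sup_eq_top {H A C : Subgroup G} [C.Normal] (hHC : H ⊔ C = ⊤) (hCA : C ≤ A)
    (hA : (A.subgroupOf H).Normal) : A.Normal := by
  have key (x : G) : ∃ h ∈ H, ∃ c ∈ C, h * c = x :=
    mem_sup_of_normal_right.1 (hHC ▸ mem_top x)
  refine ⟨fun a ha x => ?_⟩
  obtain ⟨h, hh, c, hc, rfl⟩ := key x
  have hb : c * a * c⁻¹ ∈ A := A.mul_mem (A.mul_mem (hCA hc) ha) (A.inv_mem (hCA hc))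
  obtain ⟨k, hk, d, hd, hkd⟩ := key (c * a * c⁻¹)
  have hkA : k ∈ A := by
    rw [eq_mul_inv_of_mul_eq hkd]
    exact A.mul_mem hb (A.inv_mem (hCA hd))
  have h1 : h * k * h⁻¹ ∈ A := hA.conj_mem ⟨k, hk⟩ hkA ⟨h, hh⟩
  have h2 : h * d * h⁻¹ ∈ A := hCA (Normal.conj_mem ‹_› d hd h)
  have : h * c * a * (h * c)⁻¹ = (h * k * h⁻¹) * (h * d * h⁻¹) := by
    calc _ = h * (c * a * c⁻¹) * h⁻¹ := by group
      _ = h * (k * d) * h⁻¹ := by rw [hkd]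
      _ = _ := by group
  rw [this]
  exact A.mul_mem h1 h2

/-- Schur–Zassenhaus in `G/K`: the preimage of a complement to `N/K`. -/
theorem exists_index_eq_relIndex_of_coprime [Finite G] {K N : Subgroup G} [K.Normal] [N.Normal]
    (hKN : K ≤ N) (h : Nat.Coprime (K.relIndex N) N.index) :
    ∃ C : Subgroup G, K ≤ C ∧ C.index = K.relIndex N ∧ K.relIndex C = N.index := by
  set f := QuotientGroup.mk' K
  have hf : Function.Surjective f := QuotientGroup.mk'_surjective K
  have hk : f.ker = K := QuotientGroup.ker_mk' K
  have : (N.map f).Normal := Normal.map inferInstance f hf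
  have hcard : Nat.card (N.map f) = K.relIndex N := by rw [← relIndex_ker, hk]
  have hindex : (N.map f).index = N.index := index_map_eq N hf (hk.le.trans hKN)
  obtain ⟨C, hC⟩ := exists_right_complement'_of_coprime (N := N.map f) (by rwa [hcard, hindex])
  refine ⟨C.comap f, hk.ge.trans (comap_mono bot_le), ?_, ?_⟩
  · rw [index_comap_of_surjective _ hf, hC.index_eq_card, hcard]
  · have h1 : f.ker.relIndex (C.comap f) = N.index := by
      rw [relIndex_ker, map_comap_eq_self_of_surjective hf, ← hC.symm.index_eq_card, hindex]
    rwa [hk] at h1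

/-- Every nontrivial normal subgroup `H` is the top of some chief factor `H / K`. -/
theorem exists_normal_maximal_lt [Finite G] {H : Subgroup G} [H.Normal] (hH : H ≠ ⊥) :
    ∃ K : Subgroup G, K.Normal ∧ K < H ∧
      ∀ N : Subgroup G, N.Normal → K ≤ N → N ≤ H → N = K ∨ N = H := by
  obtain ⟨K, hK⟩ := (Set.toFinite {K : Subgroup G | K.Normal ∧ K < H}).exists_maximal
    ⟨⊥, inferInstance, bot_lt_iff_ne_bot.2 hH⟩
  refine ⟨K, hK.prop.1, hK.prop.2, fun N hN hKN hNH => ?_⟩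
  rcases hNH.lt_or_eq with h | h
  · exact Or.inl ((hK.2 ⟨hN, h⟩ hKN).antisymm hKN)
  · exact Or.inr h

/-- If `K ≤ H` are normal subgroups with `H / K` cyclic, then the derived subgroup centralizes
`H / K`. -/
theorem commutator_mem_of_sup_zpowers {K H : Subgroup G} [K.Normal] [H.Normal] {g : G}
    (hg : K ⊔ zpowers g = H) {x y : G} (hx : x ∈ H) (hy : y ∈ _root_.commutator G) :
    x * y * x⁻¹ * y⁻¹ ∈ K := by
  set f := QuotientGroup.mk' K
  have hf : Function.Surjective f := QuotientGroup.mk'_surjective K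
  have hmap : H.map f = zpowers (f g) := by
    rw [← hg, map_sup, MonoidHom.map_zpowers, (map_eq_bot_iff K).2 (QuotientGroup.ker_mk' K).ge,
      bot_sup_eq]
  have : (H.map f).Normal := Normal.map inferInstance f hf
  have : IsCyclic (H.map f) := by rw [hmap]; infer_instance
  -- A cyclic group has abelian automorphism group, so commutators act trivially on `H/K`.
  let e := IsCyclic.mulAutMulEquiv (H.map f)
  let φ := (e.toMonoidHom.comp (MulAut.conjNormal (H := H.map f))).comp f
  have h1 : φ y = 1 := Abelianization.commutator_subset_ker φ hy
  have h2 : MulAut.conjNormal (H := H.map f) (f y) = 1 := e.injective (h1.trans (map_one e).symm)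
  have h3 : f y * f x * (f y)⁻¹ = f x := by
    have := congrArg (fun a : MulAut (H.map f) => ((a ⟨f x, mem_map_of_mem f hx⟩ : H.map f) : G ⧸ K)) h2
    simpa [MulAut.conjNormal_apply] using this
  rw [← QuotientGroup.eq_one_iff]
  change f (x * y * x⁻¹ * y⁻¹) = 1
  simp only [map_mul, map_inv]
  rw [mul_inv_eq_iff_eq_mul] at h3
  rw [← h3]; group

/-- If every chief factor of a finite group is cyclic, then the derived subgroup is nilpotent. -/
theorem isNilpotent_commutator_of_cyclic_chief_factors [Finite G]
    (h : ∀ K H : Subgroup G, K.Normal → H.Normal → K < H →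
      (∀ N : Subgroup G, N.Normal → K ≤ N → N ≤ H → N = K ∨ N = H) →
      ∃ g, K ⊔ zpowers g = H) :
    Group.IsNilpotent (_root_.commutator G) := by
  have key : ∀ H : Subgroup G, H.Normal →
      ∃ n, H.subgroupOf (_root_.commutator G) ≤ upperCentralSeries (_root_.commutator G) n := by
    intro H
    induction H using WellFoundedLT.induction with
    | ind H ih =>
      intro hH
      by_cases hb : H = ⊥
      · exact ⟨0, by simp [hb]⟩
      obtain ⟨K, hK, hKH, hmax⟩ := exists_normal_maximal_lt hb
      obtain ⟨g, hg⟩ := h K H hK hH hKH hmax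
      obtain ⟨n, hn⟩ := ih K hKH hK
      refine ⟨n + 1, fun x hx => ?_⟩
      rw [mem_upperCentralSeries_succ_iff]
      exact fun y => hn (commutator_mem_of_sup_zpowers hg hx y.2)
  obtain ⟨n, hn⟩ := key ⊤ inferInstance
  exact ⟨n, top_le_iff.1 hn⟩

/-- A subgroup containing all Sylow subgroups is the whole group. -/
theorem eq_top_of_sylow_le [Finite G] {H : Subgroup G}
    (h : ∀ p : ℕ, p.Prime → ∃ P : Sylow p G, (P : Subgroup G) ≤ H) : H = ⊤ := by
  rw [← index_eq_one, Nat.eq_one_iff_not_exists_prime_dvd]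
  intro p hp hdvd
  obtain ⟨P, hP⟩ := h p hp
  have := Fact.mk hp
  exact P.not_dvd_index (hdvd.trans (index_dvd_of_le hP))

end Subgroup
-- σ-subnormality and Hall subgroups
namespace SigmaGroup

open Subgroup

variable {I : Type*} {σ : I → Set ℕ} {G : Type*} [Group G]

theorem IsPiGroup.sup {π : Set ℕ} {H K : Subgroup G} [K.Normal] (hH : IsPiGroup π H)
    (hK : IsPiGroup π K) : IsPiGroup π (H ⊔ K : Subgroup G) := by
  intro p hp hd
  rw [← relIndex_bot_left, ← relIndex_mul_relIndex ⊥ K _ bot_le le_sup_right,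
    relIndex_bot_left, relIndex_sup_right, hp.dvd_mul] at hd
  exact hd.elim (hK p hp) fun h => hH p hp (h.trans (relIndex_dvd_card ..))

theorem isPiGroup_sylow {π : Set ℕ} {p : ℕ} [Finite G] (hp : p.Prime) (hpπ : p ∈ π)
    (P : Sylow p G) : IsPiGroup π P := by
  intro q hq hd
  have := Fact.mk hp
  obtain ⟨n, hn⟩ := P.2.exists_card_eq
  rw [hn] at hd
  rwa [(Nat.prime_dvd_prime_iff_eq hq hp).1 (hq.dvd_of_dvd_pow hd)]

/-- `|S : H ∩ S|` divides both `|G : H|` and `|S|`. -/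
theorem IsHallSubgroup.le_of_normal [Finite G] {π : Set ℕ} {H S : Subgroup G} [S.Normal]
    (hH : IsHallSubgroup π H) (hS : IsPiGroup π S) : S ≤ H := by
  rw [← relIndex_eq_one, Nat.eq_one_iff_not_exists_prime_dvd]
  exact fun p hp hd => hH.2 p hp (hd.trans (relIndex_dvd_index_of_normal_right H S))
    (hS p hp (hd.trans (relIndex_dvd_card ..)))

theorem IsTSigmaGroup.normal_of_le_of_le (hT : IsTSigmaGroup σ G) {K A M : Subgroup G}
    [K.Normal] [M.Normal] (hKA : K ≤ A) (hAM : A ≤ M) {i : I}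
    (h : IsPiGroup (σ i) (M ⧸ K.subgroupOf M)) : A.Normal := by
  refine hT A ⟨2, fun | 0 => A | 1 => M | _ => ⊤, rfl, rfl, fun j hj => ?_⟩
  interval_cases j
  · refine ⟨hAM, Or.inr ⟨i, fun p hp hd => h p hp (hd.trans ?_)⟩⟩
    -- The core of `A` in `M` contains `K`.
    exact index_dvd_of_le (normal_le_normalCore.2 (comap_mono hKA))
  · exact ⟨le_top, Or.inl inferInstance⟩

theorem IsTSigmaGroup.isTGroup (hT : IsTSigmaGroup σ G) : IsTGroup G := by
  intro H K hHK hH hK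
  refine hT H ⟨2, fun | 0 => H | 1 => K | _ => ⊤, rfl, rfl, fun j hj => ?_⟩
  interval_cases j
  · exact ⟨hHK, Or.inl hH⟩
  · exact ⟨le_top, Or.inl inferInstance⟩

theorem IsTSigmaGroup.isNilpotent_commutator [Finite G] (hG : IsSigmaSoluble σ G)
    (hT : IsTSigmaGroup σ G) : Group.IsNilpotent (_root_.commutator G) := by
  refine isNilpotent_commutator_of_cyclic_chief_factors fun K H hK hH hKH hmax => ?_
  obtain ⟨i, hi⟩ := hG K H hKH hmax
  obtain ⟨g, hgH, hgK⟩ := SetLike.exists_of_lt hKH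
  have hle : K ⊔ zpowers g ≤ H := sup_le hKH.le (zpowers_le.2 hgH)
  have hn : (K ⊔ zpowers g).Normal := hT.normal_of_le_of_le le_sup_left hle hi
  refine ⟨g, (hmax _ hn le_sup_left hle).resolve_left fun h => hgK ?_⟩
  exact h ▸ mem_sup_right (mem_zpowers g)

theorem IsTSigmaGroup.isDedekindGroup_of_isHallSubgroup [Finite G] (hG : IsSigmaSoluble σ G)
    (hT : IsTSigmaGroup σ G) {i : I} {H : Subgroup G} (hH : IsHallSubgroup (σ i) H) :
    IsDedekindGroup H := by
  have hnil := hT.isNilpotent_commutator hG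
  obtain ⟨N, hN⟩ := (Set.toFinite {N : Subgroup G | N.Normal ∧ IsPiGroup (σ i)ᶜ N}).exists_maximal
    ⟨⊥, inferInstance, fun p hp hd => by simp [hp.ne_one] at hd⟩
  have := hN.prop.1
  have hNmax (S : Subgroup G) (hS : S.Normal) (hSπ : IsPiGroup (σ i)ᶜ S) : S ≤ N :=
    le_sup_right.trans (hN.2 ⟨inferInstance, hN.prop.2.sup hSπ⟩ (le_sup_left : N ≤ N ⊔ S))
  have hdisj : H ⊓ N = ⊥ := by
    rw [← card_eq_one, Nat.eq_one_iff_not_exists_prime_dvd]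
    exact fun p hp hd => hN.prop.2 p hp (hd.trans (card_dvd_of_le inf_le_right))
      (hH.1 p hp (hd.trans (card_dvd_of_le inf_le_left)))
  have hcomm : _root_.commutator G ≤ H ⊔ N := by
    rw [← subgroupOf_eq_top]
    refine eq_top_of_sylow_le fun p hp => ?_
    have := Fact.mk hp
    obtain ⟨P⟩ : Nonempty (Sylow p (_root_.commutator G)) := inferInstance
    have hPn : (P : Subgroup (_root_.commutator G)).Normal :=
      ((Group.isNilpotent_of_finite_tfae (G := _root_.commutator G)).out 0 3 :
        _ ↔ ∀ (p : ℕ) (_ : Fact p.Prime) (P : Sylow p (_root_.commutator G)),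
          (P : Subgroup (_root_.commutator G)).Normal).1 hnil p this P
    have := P.characteristic_of_normal hPn
    have hcard : Nat.card ((P : Subgroup (_root_.commutator G)).map
        (_root_.commutator G).subtype) = Nat.card P :=
      card_map_of_injective (subtype_injective _)
    refine ⟨P, ?_⟩
    rw [subgroupOf, ← map_le_iff_le_comap]
    by_cases hpi : p ∈ σ i
    · refine le_sup_of_le_left (hH.le_of_normal ?_)
      intro q hq hd
      exact isPiGroup_sylow hp hpi P q hq (hcard ▸ hd)
    · refine le_sup_of_le_right (hNmax _ inferInstance ?_)
      intro q hq hd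
      exact isPiGroup_sylow (π := (σ i)ᶜ) hp hpi P q hq (hcard ▸ hd)
  have hHN : (H ⊔ N).Normal := Normal.of_commutator_le _ hcomm
  intro A
  have hAH : A.map H.subtype ≤ H := map_subtype_le A
  have hAN : (A.map H.subtype ⊔ N).Normal := by
    refine hT.normal_of_le_of_le (K := N) (M := H ⊔ N) (i := i) le_sup_right
      (sup_le_sup_right hAH N) fun p hp hd => hH.1 p hp (hd.trans ?_)
    change N.relIndex (H ⊔ N) ∣ _
    rw [relIndex_sup_right]
    exact relIndex_dvd_card ..
  have hA : A = (A.map H.subtype ⊔ N).subgroupOf H := by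
    refine le_antisymm (fun x hx => mem_sup_left (mem_map_of_mem _ hx)) fun x hx => ?_
    obtain ⟨_, ⟨a, ha, rfl⟩, n, hn, hx⟩ := mem_sup_of_normal_right.1 hx
    have hn1 : n ∈ H ⊓ N := ⟨by
      rw [eq_inv_mul_of_mul_eq hx]
      exact H.mul_mem (H.inv_mem a.2) x.2, hn⟩
    rw [hdisj, mem_bot] at hn1
    rw [hn1, mul_one] at hx
    exact Subtype.ext hx ▸ ha
  rw [hA]
  infer_instance

/-- Modulo any normal subgroup, a `σ`-soluble group has a Hall `σ i`-subgroup. -/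
theorem IsSigmaSoluble.exists_relIndex [Finite G] (hσ : IsPrimePartition σ)
    (hG : IsSigmaSoluble σ G) (i : I) (N : Subgroup G) (hN : N.Normal) :
    ∃ H : Subgroup G, N ≤ H ∧ (∀ p : ℕ, p.Prime → p ∣ N.relIndex H → p ∈ σ i) ∧
      ∀ p : ℕ, p.Prime → p ∣ H.index → p ∉ σ i := by
  induction N using WellFoundedGT.induction with
  | ind N ih =>
  by_cases htop : N = ⊤
  · exact ⟨⊤, le_top, fun p hp hd => by simp [htop, hp.ne_one] at hd,
      fun p hp hd => by simp [hp.ne_one] at hd⟩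
  obtain ⟨M, ⟨hM, hNM⟩, hmin⟩ := (Set.toFinite {M : Subgroup G | M.Normal ∧ N < M}).exists_minimal
    ⟨⊤, inferInstance, lt_top_iff_ne_top.2 htop⟩
  obtain ⟨j, hj⟩ := hG N M hNM fun L hL hNL hLM => by
    rcases hNL.eq_or_lt with h | h
    · exact Or.inl h.symm
    · exact Or.inr (hLM.antisymm (hmin ⟨hL, h⟩ hLM))
  replace hj : ∀ p : ℕ, p.Prime → p ∣ N.relIndex M → p ∈ σ j := hj
  obtain ⟨H, hMH, hπ, hπ'⟩ := ih M hNM hM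
  by_cases hij : j = i
  · subst hij
    refine ⟨H, hNM.le.trans hMH, fun p hp hd => ?_, hπ'⟩
    rw [← relIndex_mul_relIndex N M H hNM.le hMH, hp.dvd_mul] at hd
    exact hd.elim (hj p hp) (hπ p hp)
  have hdisj {p : ℕ} (h : p ∈ σ j) : p ∉ σ i :=
    Set.disjoint_left.1 (hσ.disjoint j i hij) h
  -- Here `M/N` is a σⱼ-group with `j ≠ i`, so its order is coprime to `|H : M|`; a complement to
  -- `M/N` in `H/N` is the required Hall subgroup modulo `N`.
  obtain ⟨C, hNC, hC, hC'⟩ := exists_index_eq_relIndex_of_coprime (K := N.subgroupOf H)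
    (N := M.subgroupOf H) (comap_mono hNM.le) (by
      rw [relIndex_subgroupOf hMH]
      exact Nat.coprime_of_dvd fun p hp h1 h2 => hdisj (hj p hp h1) (hπ p hp h2))
  rw [relIndex_subgroupOf hMH] at hC
  refine ⟨C.map H.subtype, ?_, fun p hp hd => ?_, fun p hp hd => ?_⟩
  · rw [← map_subgroupOf_eq_of_le (hNM.le.trans hMH)]
    exact map_mono hNC
  · rw [← relIndex_comap] at hd
    exact hπ p hp (hd.trans hC'.dvd)
  · rw [index_map_subtype, hC, hp.dvd_mul] at hd
    exact hd.elim (fun h => hdisj (hj p hp h)) (hπ' p hp)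

theorem IsSigmaSoluble.exists_isHallSubgroup [Finite G] (hσ : IsPrimePartition σ)
    (hG : IsSigmaSoluble σ G) (i : I) : ∃ H : Subgroup G, IsHallSubgroup (σ i) H := by
  obtain ⟨H, -, hπ, hπ'⟩ := hG.exists_relIndex hσ i ⊥ inferInstance
  exact ⟨H, fun p hp hd => hπ p hp (by rwa [relIndex_bot_left]), hπ'⟩

theorem IsTGroup.isTSigmaGroup [Finite G] (hT : IsTGroup G)
    (hH : ∀ i, ∃ H : Subgroup G, IsHallSubgroup (σ i) H ∧ IsDedekindGroup H) :
    IsTSigmaGroup σ G := by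
  rintro A ⟨n, c, rfl, hn, hc⟩
  refine Nat.decreasingInduction' (P := fun k => (c k).Normal) (fun k hk _ hM => ?_)
    (Nat.zero_le n) (hn ▸ inferInstance)
  obtain ⟨hle, hnorm | ⟨i, hi⟩⟩ := hc k hk
  · exact hT _ _ hle hnorm hM
  refine hT _ _ hle ?_ hM
  obtain ⟨H, hHall, hDed⟩ := hH i
  set M := c (k + 1)
  set C := ((c k).subgroupOf M).normalCore
  refine normal_of_sup_eq_top (H := H.subgroupOf M) (C := C) ?_ (normalCore_le _) ?_
  · rw [← index_eq_one, Nat.eq_one_iff_not_exists_prime_dvd]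
    intro p hp hd
    -- A prime dividing `|M : (H ∩ M)C|` divides `|M : C|`, so lies in σᵢ, yet also divides `|G :
    -- H|`.
    refine hHall.2 p hp ?_ (hi p hp (hd.trans (index_dvd_of_le le_sup_right)))
    exact (hd.trans (index_dvd_of_le le_sup_left)).trans (relIndex_dvd_index_of_normal_right H M)
  · refine ⟨fun a ha x => ?_⟩
    have hD := hDed ((c k).subgroupOf H)
    exact hD.conj_mem ⟨a, a.2⟩ ha ⟨x, x.2⟩

end SigmaGroup

theorem corollary2p17 {I : Type*} (σ : I → Set ℕ) (hσ : SigmaGroup.IsPrimePartition σ)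
    (G : Type*) [Group G] [Finite G] (hG : SigmaGroup.IsSigmaSoluble σ G) :
    SigmaGroup.IsTSigmaGroup σ G ↔
      (SigmaGroup.IsTGroup G ∧
        ∀ (i : I) (H : Subgroup G), SigmaGroup.IsHallSubgroup (σ i) H →
          SigmaGroup.IsDedekindGroup H) := by
  refine ⟨fun hT => ⟨hT.isTGroup, fun i H hH => hT.isDedekindGroup_of_isHallSubgroup hG hH⟩, ?_⟩
  rintro ⟨hT, hD⟩
  refine hT.isTSigmaGroup fun i => ?_
  obtain ⟨H, hH⟩ := hG.exists_isHallSubgroup hσ i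
  exact ⟨H, hH, hD i H hH⟩
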